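/- Let $(\mathcal X,d)$ be a complete separable metric space which is geodesic: any two points $x,y$ are joined by a (constant-speed) geodesic, i.e. a family $(x_t)_{t\in[0,1]}$ with $x_0=x$, $x_1=y$ and $d(x_s,x_t)=|t-s|\,d(x_0,x_1)$ for all $s,t\in[0,1]$. A subset of a metric space is called convex if it contains all geodesics joining two of its points, and a function $f:\mathcal X\to\mathbb R$ is called convex if $f(x_t)\le(1-t)f(x_0)+tf(x_1)$ for every geodesic $(x_t)_{t\in[0,1]}$ and every $t\in[0,1]$. Equip $\mathcal X^n$ with $d_2(x,y)=\big(\sum_{i=1}^n d(x_i,y_i)^2\big)^{1/2}$, and for $A\subset\mathcal X^n$ and $r\ge0$ let $A_{r,2}=\{x\in\mathcal X^n : d_2(x,A)\le r\}$. Let $\mu$ be a Borel probability measure on $\mathcal X$ and $\alpha:[0,\infty)\to[0,\infty)$ a non-increasing function. Assume that $\mu$ satisfies the dimension-free convex concentration property $\mathbf{CCI}_2^\infty(\alpha)$: for every $n\ge1$ and every convex Borel set $A\subset\mathcal X^n$ with $\mu^n(A)\ge 1/2$, $$\mu^n(A_{r,2})\ge 1-\alpha(r)\qquad\text{for all } r\ge0.$$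 Let $\lambda\in[0,+\infty]$ be defined by $$\sqrt\lambda=\sup\left\{\frac{\overline\Phi^{-1}(\alpha(r))}{r}\;;\; r>0,\ \alpha(r)\le \tfrac12\right\},\qquad \overline\Phi(x)=\frac1{\sqrt{2\pi}}\int_x^{+\infty}e^{-u^2/2}\,du,$$ with $\overline\Phi^{-1}(0)=+\infty$ and $\sup\emptyset=0$. For $f:\mathcal X\to\mathbb R$ let $$|\nabla^-f|(x)=\limsup_{y\to x}\frac{[f(y)-f(x)]_-}{d(y,x)},\qquad [a]_-=\max(-a,0),$$ if $x$ is not isolated, and $|\nabla^-f|(x)=0$ if $x$ is isolated. Then, with the convention $\infty\cdot0=0$, $$\lambda\,\mathrm{Var}_\mu(f)\le\int|\nabla^-f|^2\,d\mu$$ for every convex function $f:\mathcal X\to\mathbb R$ which is Lipschitz on every ball of finite radius and has finite variance under $\mu$ (the right-hand side may be $+\infty$). If moreover $\int_0^\infty r\,\alpha(r)\,dr<\infty$, then every convex Lipschitz function $f:\mathcal X\to\mathbb R$ has finite variance under $\mu$ and satisfies the same inequality. -/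

import Mathlib

open MeasureTheory ProbabilityTheory Set Filter Topology
open scoped ENNReal

/-- `γ`, restricted to `[0, 1]`, is a constant-speed geodesic (joining `γ 0` to `γ 1`). -/
def IsConstSpeedGeodesic {Y : Type*} [MetricSpace Y] (γ : ℝ → Y) : Prop :=
  ∀ s ∈ Icc (0 : ℝ) 1, ∀ t ∈ Icc (0 : ℝ) 1, dist (γ s) (γ t) = |t - s| * dist (γ 0) (γ 1)

/-- Any two points are joined by at least one constant-speed geodesic. -/
def IsGeodesicMetricSpace (Y : Type*) [MetricSpace Y] : Prop :=
  ∀ x y : Y, ∃ γ : ℝ → Y, IsConstSpeedGeodesic γ ∧ γ 0 = x ∧ γ 1 = y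

/-- A set is convex if it contains every geodesic between any two of its points. -/
def IsGeodesicallyConvexSet {Y : Type*} [MetricSpace Y] (A : Set Y) : Prop :=
  ∀ γ : ℝ → Y, IsConstSpeedGeodesic γ → γ 0 ∈ A → γ 1 ∈ A → ∀ t ∈ Icc (0 : ℝ) 1, γ t ∈ A

/-- A real function is convex if it is convex along every geodesic. -/
def IsGeodesicallyConvexFun {Y : Type*} [MetricSpace Y] (f : Y → ℝ) : Prop :=
  ∀ γ : ℝ → Y, IsConstSpeedGeodesic γ → ∀ t ∈ Icc (0 : ℝ) 1,
    f (γ t) ≤ (1 - t) * f (γ 0) + t * f (γ 1)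

/-- Lipschitz on every ball of finite radius. -/
def LipschitzOnBalls {Y : Type*} [MetricSpace Y] (f : Y → ℝ) : Prop :=
  ∀ (x : Y) (r : ℝ), ∃ K : NNReal, LipschitzOnWith K f (Metric.ball x r)

/-- The descending slope `|∇⁻f|(x) = limsup_{y → x} [f y - f x]₋ / d(y, x)`, as an element of
`[0, ∞]`. At an isolated point the filter `𝓝[≠] x` is trivial and the value is `0`. -/
noncomputable def gradMinus {Y : Type*} [MetricSpace Y] (f : Y → ℝ) (x : Y) : ℝ≥0∞ :=
  limsup (fun y : Y => ENNReal.ofReal (max (-(f y - f x)) 0 / dist y x)) (𝓝[≠] x)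

/-- Tail distribution function of the standard Gaussian measure. -/
noncomputable def gaussianTail (x : ℝ) : ℝ := (gaussianReal 0 1).real (Ici x)

/-- The (generalized) inverse of `gaussianTail`; it is the inverse function on `(0, 1)`, and
takes the value `+∞` at `0`. -/
noncomputable def gaussianTailInv (a : ℝ) : EReal :=
  sInf ((fun x : ℝ => (x : EReal)) '' {x : ℝ | gaussianTail x ≤ a})

/-- The constant `λ ∈ [0, ∞]`, where `√λ` is the supremum in `[0, ∞]` of `Φ̄⁻¹(α(r)) / r` over all
`r > 0` with `α(r) ≤ 1/2` (for these `r` the quotient is nonnegative; the supremum of the empty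
set is `0`). -/
noncomputable def concentrationConst (α : ℝ → ℝ) : ℝ≥0∞ :=
  (⨆ (r : ℝ) (_ : 0 < r ∧ α r ≤ 1 / 2), (gaussianTailInv (α r) / (r : EReal)).toENNReal) ^ 2

/-- Dimension-free convex concentration with profile `α` for the `ℓ²` product structure:
`PiLp 2` carries the distance `d₂`, `Measure.pi` is the product measure `μⁿ`, and
`Metric.cthickening r A` is the enlargement `{x | d₂(x, A) ≤ r}`. -/
def DimFreeConvexConcentration {X : Type*} [MetricSpace X] [MeasurableSpace X]
    (μ : Measure X) (α : ℝ → ℝ) : Prop :=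
  ∀ n : ℕ, 1 ≤ n → ∀ A : Set (PiLp 2 (fun _ : Fin n => X)),
    MeasurableSet (WithLp.toLp 2 ⁻¹' A : Set (Fin n → X)) →
    IsGeodesicallyConvexSet A →
    1 / 2 ≤ (Measure.pi (fun _ : Fin n => μ)).real (WithLp.toLp 2 ⁻¹' A) →
    ∀ r : ℝ, 0 ≤ r →
      1 - α r ≤ (Measure.pi (fun _ : Fin n => μ)).real
        (WithLp.toLp 2 ⁻¹' Metric.cthickening r A)

/-!
Let `f` be convex. Its descending slope `g` is defined locally, but convexity along geodesics makes
it global: `f x - f y ≤ g x * dist x y` for all `y` (`ofReal_div_le_gradMinus`). Moreover the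
function `x ↦ ∑ i, f (x i)` on the `ℓ²` product is again convex, since coordinates of geodesics are
geodesics (`IsConstSpeedGeodesic.apply`), so concentration applies to its sublevel sets
`A = {∑ i, f (x i) ≤ m}`. By the Cauchy-Schwarz inequality, at a point `x` at distance at most `r`
from `A`, `∑ i, f (x i) ≤ m + r * √(∑ i, g (x i) ^ 2)`. Hence, if `A` has measure at least `1 / 2`,
the opposite inequality has probability at most `α r` (`measureReal_sum_gt_le`).

Take `m = n * 𝔼 f + δ * √n`, which is admissible for large `n` by the central limit theorem, and
let `n → ∞`. With `σ² = Var f` and `G = ∫ g²`, the central limit theorem for the sum of the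
`f (x i)`, the law of large numbers for the sum of the `g (x i) ^ 2` and Slutsky's theorem give
`ℙ (σ N > δ + r * √G) ≤ α r` for a standard Gaussian `N` (`gaussianTail_le_of_forall_pi`). As
`δ → 0` this says that `Φ̄⁻¹ (α r) / r ≤ √G / σ`, and the supremum over `r` is the inequality
`λ * σ² ≤ G` (`mul_evariance_le`).

If `r * α r` is integrable, then `α r < 1 / 2` for some `r`, so `λ > 0`. For a convex `K`-Lipschitz
function `f`, concentration with `n = 1` bounds the upper tail, so that the truncations `max f (-k)`
are square integrable (`memLp_max_const`). They are convex and `K`-Lipschitz, hence their variances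
are at most `K² / λ`, uniformly in `k`, and `f` is square integrable by Fatou's lemma
(`memLp_two`).
-/

/-! ### Geodesics and convexity in `ℓ²` products -/

lemma PiLp.sq_dist_eq_sum {ι : Type*} [Fintype ι] {X : Type*} [MetricSpace X]
    (x y : PiLp 2 (fun _ : ι => X)) : dist x y ^ 2 = ∑ i, dist (x i) (y i) ^ 2 := by
  rw [PiLp.dist_eq_sum (by norm_num)]
  have h : 0 ≤ ∑ i, dist (x i) (y i) ^ 2 := Finset.sum_nonneg fun i _ => sq_nonneg _
  simp only [ENNReal.toReal_ofNat, Real.rpow_ofNat]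
  rw [← Real.sqrt_eq_rpow, Real.sq_sqrt h]

lemma PiLp.sum_dist_mul_dist_le {ι : Type*} [Fintype ι] {X : Type*} [MetricSpace X]
    (x y z w : PiLp 2 (fun _ : ι => X)) :
    ∑ i, dist (x i) (y i) * dist (z i) (w i) ≤ dist x y * dist z w := by
  refine abs_le_of_sq_le_sq' ?_ (by positivity) |>.2
  rw [mul_pow, PiLp.sq_dist_eq_sum, PiLp.sq_dist_eq_sum]
  exact Finset.sum_mul_sq_le_sq_mul_sq _ _ _

/-- The coordinates of a constant-speed geodesic of an `ℓ²` product are constant-speed geodesics.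
This is where strict convexity of the `ℓ²` norm enters: equality holds in the Cauchy-Schwarz
inequality between the vectors of coordinate distances of `(γ s, γ t)` and of `(γ 0, γ 1)`. -/
lemma IsConstSpeedGeodesic.apply {ι : Type*} [Fintype ι] {X : Type*} [MetricSpace X]
    {γ : ℝ → PiLp 2 (fun _ : ι => X)} (hγ : IsConstSpeedGeodesic γ) (i : ι) :
    IsConstSpeedGeodesic (fun t => γ t i) := by
  have key : ∀ s ∈ Icc (0 : ℝ) 1, ∀ t ∈ Icc (0 : ℝ) 1, s ≤ t →
      dist (γ s i) (γ t i) = (t - s) * dist (γ 0 i) (γ 1 i) := by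
    intro s hs t ht hst
    have h0 : (0 : ℝ) ∈ Icc (0 : ℝ) 1 := by simp
    have h1 : (1 : ℝ) ∈ Icc (0 : ℝ) 1 := by simp
    have d0 := hγ 0 h0 s hs
    have dst := hγ s hs t ht
    have d1 := hγ t ht 1 h1
    rw [abs_of_nonneg (by linarith [hs.1])] at d0
    rw [abs_of_nonneg (by linarith)] at dst
    rw [abs_of_nonneg (by linarith [ht.2])] at d1
    set D := dist (γ 0) (γ 1) with hD
    have c0 := PiLp.sum_dist_mul_dist_le (γ 0) (γ s) (γ 0) (γ 1)
    have c1 := PiLp.sum_dist_mul_dist_le (γ t) (γ 1) (γ 0) (γ 1)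
    have cst := PiLp.sum_dist_mul_dist_le (γ s) (γ t) (γ 0) (γ 1)
    have sD := PiLp.sq_dist_eq_sum (γ 0) (γ 1)
    have sst := PiLp.sq_dist_eq_sum (γ s) (γ t)
    have tri : ∑ j, dist (γ 0 j) (γ 1 j) ^ 2 ≤
        ∑ j, dist (γ 0 j) (γ s j) * dist (γ 0 j) (γ 1 j) +
        ∑ j, dist (γ s j) (γ t j) * dist (γ 0 j) (γ 1 j) +
        ∑ j, dist (γ t j) (γ 1 j) * dist (γ 0 j) (γ 1 j) := by
      rw [← Finset.sum_add_distrib, ← Finset.sum_add_distrib]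
      refine Finset.sum_le_sum fun j _ => ?_
      have := dist_triangle4 (γ 0 j) (γ s j) (γ t j) (γ 1 j)
      nlinarith [dist_nonneg (x := γ 0 j) (y := γ 1 j)]
    rw [d0] at c0; rw [d1] at c1; rw [dst] at cst sst
    rw [← hD] at c0 c1 cst sD
    have eqst : (t - s) * D ^ 2 ≤ ∑ j, dist (γ s j) (γ t j) * dist (γ 0 j) (γ 1 j) := by
      nlinarith
    have zero : ∑ j, (dist (γ s j) (γ t j) - (t - s) * dist (γ 0 j) (γ 1 j)) ^ 2 ≤ 0 := by
      have : ∑ j, (dist (γ s j) (γ t j) - (t - s) * dist (γ 0 j) (γ 1 j)) ^ 2 =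
          ∑ j, dist (γ s j) (γ t j) ^ 2
          - 2 * (t - s) * ∑ j, dist (γ s j) (γ t j) * dist (γ 0 j) (γ 1 j)
          + (t - s) ^ 2 * ∑ j, dist (γ 0 j) (γ 1 j) ^ 2 := by
        rw [Finset.mul_sum, Finset.mul_sum, ← Finset.sum_sub_distrib, ← Finset.sum_add_distrib]
        exact Finset.sum_congr rfl fun j _ => by ring
      rw [this, ← sst, ← sD]
      have := mul_le_mul_of_nonneg_left eqst (by linarith : 0 ≤ 2 * (t - s))
      linarith
    have := (Finset.sum_eq_zero_iff_of_nonneg (fun j _ => sq_nonneg _)).1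
      (le_antisymm zero (Finset.sum_nonneg fun j _ => sq_nonneg _)) i (Finset.mem_univ i)
    linarith [pow_eq_zero_iff (two_ne_zero) |>.1 this]
  intro s hs t ht
  rcases le_total s t with h | h
  · rw [key s hs t ht h, abs_of_nonneg (by linarith)]
  · rw [dist_comm, key t ht s hs h, abs_of_nonpos (by linarith), neg_sub]

lemma IsGeodesicallyConvexFun.isGeodesicallyConvexSet_sum_le {ι : Type*} [Fintype ι] {X : Type*}
    [MetricSpace X] {f : X → ℝ} (hf : IsGeodesicallyConvexFun f) (m : ℝ) :
    IsGeodesicallyConvexSet {x : PiLp 2 (fun _ : ι => X) | ∑ i, f (x i) ≤ m} := by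
  intro γ hγ h0 h1 t ht
  simp only [mem_ofPred_eq] at h0 h1 ⊢
  calc ∑ i, f (γ t i) ≤ ∑ i, ((1 - t) * f (γ 0 i) + t * f (γ 1 i)) :=
        Finset.sum_le_sum fun i _ => hf _ (hγ.apply i) t ht
    _ = (1 - t) * ∑ i, f (γ 0 i) + t * ∑ i, f (γ 1 i) := by
        rw [Finset.sum_add_distrib, Finset.mul_sum, Finset.mul_sum]
    _ ≤ m := by nlinarith [ht.1, ht.2]

/-! ### The descending slope of a convex function -/

section slope
variable {X : Type*} [MetricSpace X] {f : X → ℝ}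

lemma gradMinus_le_of_eventually {x : X} {K : NNReal}
    (h : ∀ᶠ y in 𝓝 x, f x - f y ≤ K * dist y x) : gradMinus f x ≤ K := by
  refine limsup_le_of_le (by isBoundedDefault) ?_
  filter_upwards [eventually_nhdsWithin_of_eventually_nhds h, self_mem_nhdsWithin] with y hy hne
  have hd : 0 < dist y x := dist_pos.2 hne
  rw [← ENNReal.ofReal_coe_nnreal]
  refine ENNReal.ofReal_le_ofReal ?_
  rw [div_le_iff₀ hd]
  exact max_le (by linarith) (by positivity)

/-- For a convex function the descending slope, although defined locally, controls all difference
quotients: along a geodesic from `x` to `y` the difference quotient at `x` is nonincreasing in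
the distance to `x`. -/
lemma IsGeodesicallyConvexFun.ofReal_div_le_gradMinus (hX : IsGeodesicMetricSpace X)
    (hf : IsGeodesicallyConvexFun f) (x y : X) :
    ENNReal.ofReal ((f x - f y) / dist x y) ≤ gradMinus f x := by
  rcases eq_or_ne x y with rfl | hne
  · simp
  have hd : 0 < dist x y := dist_pos.2 hne
  obtain ⟨γ, hγ, h0, h1⟩ := hX x y
  have hdist : ∀ t ∈ Ioo (0 : ℝ) 1, dist (γ t) x = t * dist x y := by
    intro t ht
    have := hγ 0 (by simp) t ⟨ht.1.le, ht.2.le⟩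
    rwa [h0, h1, sub_zero, abs_of_pos ht.1, dist_comm] at this
  have hev : ∀ᶠ t in 𝓝[>] (0 : ℝ), t ∈ Ioo (0 : ℝ) 1 := Ioo_mem_nhdsGT one_pos
  have htend : Tendsto γ (𝓝[>] 0) (𝓝[≠] x) := by
    refine tendsto_nhdsWithin_iff.2 ⟨?_, ?_⟩
    · rw [tendsto_iff_dist_tendsto_zero]
      have : Tendsto (fun t : ℝ => t * dist x y) (𝓝[>] 0) (𝓝 (0 * dist x y)) :=
        (tendsto_nhdsWithin_of_tendsto_nhds tendsto_id).mul_const _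
      rw [zero_mul] at this
      refine this.congr' ?_
      filter_upwards [hev] with t ht using (hdist t ht).symm
    · filter_upwards [hev] with t ht
      refine dist_pos.1 ?_
      rw [hdist t ht]
      exact mul_pos ht.1 hd
  refine le_limsup_of_frequently_le (htend.frequently (Eventually.frequently ?_))
  filter_upwards [hev] with t ht
  refine ENNReal.ofReal_le_ofReal ?_
  rw [hdist t ht, div_le_div_iff₀ hd (mul_pos ht.1 hd)]
  have hc := hf γ hγ t ⟨ht.1.le, ht.2.le⟩
  rw [h0, h1] at hc
  calc (f x - f y) * (t * dist x y) = (t * (f x - f y)) * dist x y := by ring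
    _ ≤ (-(f (γ t) - f x)) * dist x y := by gcongr; linarith
    _ ≤ max (-(f (γ t) - f x)) 0 * dist x y := by gcongr; exact le_max_left _ _

lemma LipschitzOnBalls.continuous (hf : LipschitzOnBalls f) : Continuous f := by
  refine continuous_iff_continuousAt.2 fun x => ?_
  obtain ⟨K, hK⟩ := hf x 1
  exact hK.continuousOn.continuousAt (Metric.ball_mem_nhds x one_pos)

lemma LipschitzOnBalls.gradMinus_lt_top (hf : LipschitzOnBalls f) (x : X) :
    gradMinus f x < ∞ := by
  obtain ⟨K, hK⟩ := hf x 1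
  refine lt_of_le_of_lt (gradMinus_le_of_eventually (K := K) ?_) ENNReal.coe_lt_top
  filter_upwards [Metric.ball_mem_nhds x one_pos] with y hy
  have := hK.dist_le_mul x (Metric.mem_ball_self one_pos) y hy
  rw [Real.dist_eq, dist_comm x y] at this
  exact (le_abs_self _).trans this

/-- A measurable real-valued form of the descending slope: the supremum of the difference
quotients over a countable dense set. By continuity of `f` it bounds all difference quotients. -/
lemma IsGeodesicallyConvexFun.exists_measurable_slope [SecondCountableTopology X]
    [MeasurableSpace X] [BorelSpace X] (hX : IsGeodesicMetricSpace X)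
    (hf : IsGeodesicallyConvexFun f) (hL : LipschitzOnBalls f) :
    ∃ h : X → ℝ, Measurable h ∧ (∀ x, 0 ≤ h x) ∧ (∀ x y, f x - f y ≤ h x * dist x y) ∧
      ∀ x, ENNReal.ofReal (h x) ≤ gradMinus f x := by
  have hc := hL.continuous
  obtain ⟨s, hs, hsd⟩ := TopologicalSpace.exists_countable_dense X
  have : Countable s := hs
  set G : X → ℝ≥0∞ := fun x => ⨆ d : s, ENNReal.ofReal ((f x - f d) / dist x d) with hG
  have hGle : ∀ x, G x ≤ gradMinus f x := fun x =>
    iSup_le fun d => hf.ofReal_div_le_gradMinus hX x d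
  have hGtop : ∀ x, G x ≠ ∞ := fun x => ((hGle x).trans_lt (hL.gradMinus_lt_top x)).ne
  have hGm : Measurable G := by
    refine Measurable.iSup fun d => ?_
    have := hc.measurable
    fun_prop
  refine ⟨fun x => (G x).toReal, hGm.ennreal_toReal, fun x => ENNReal.toReal_nonneg,
    fun x y => ?_, fun x => ?_⟩
  · have hclosed : IsClosed {z : X | f x - f z ≤ (G x).toReal * dist x z} :=
      isClosed_le (by fun_prop) (by fun_prop)
    refine hclosed.closure_subset_iff.2 (fun d hd => ?_) (hsd y)
    rcases eq_or_ne x d with rfl | hne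
    · simp
    have hd' : 0 < dist x d := dist_pos.2 hne
    have h1 : ENNReal.ofReal ((f x - f d) / dist x d) ≤ G x :=
      le_iSup (fun d : s => ENNReal.ofReal ((f x - f d) / dist x d)) ⟨d, hd⟩
    have h2 := (ENNReal.ofReal_le_iff_le_toReal (hGtop x)).1 h1
    exact (div_le_iff₀ hd').1 h2
  · rw [ENNReal.ofReal_toReal (hGtop x)]
    exact hGle x

end slope

/-! ### Deviation inequalities for sums of convex functions -/

/-- If `h` bounds the descending difference quotients of `f`, moving by `r` in `ℓ²` distance away
from a sublevel set of `x ↦ ∑ i, f (x i)` raises this sum by at most `r` times the `ℓ²` norm of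
the slopes, taken at the end point. -/
lemma sum_le_of_mem_cthickening {ι : Type*} [Fintype ι] {X : Type*} [MetricSpace X] {f h : X → ℝ}
    (hfh : ∀ x y, f x - f y ≤ h x * dist x y) {m r : ℝ} (hr : 0 ≤ r)
    {x : PiLp 2 (fun _ : ι => X)}
    (hx : x ∈ Metric.cthickening r {x : PiLp 2 (fun _ : ι => X) | ∑ i, f (x i) ≤ m}) :
    ∑ i, f (x i) ≤ m + r * √(∑ i, h (x i) ^ 2) := by
  set S := √(∑ i, h (x i) ^ 2) with hS
  have key : ∀ r' > r, ∑ i, f (x i) ≤ m + r' * S := by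
    intro r' hr'
    have hr0 : 0 < r' := hr.trans_lt hr'
    rw [Metric.mem_cthickening_iff] at hx
    obtain ⟨y, hy, hxy⟩ := Metric.infEDist_lt_iff.1
      (hx.trans_lt ((ENNReal.ofReal_lt_ofReal_iff hr0).2 hr'))
    have hxy' : dist x y < r' := by
      rw [edist_dist] at hxy
      exact (ENNReal.ofReal_lt_ofReal_iff hr0).1 hxy
    have hcs : ∑ i, h (x i) * dist (x i) (y i) ≤ S * dist x y := by
      refine abs_le_of_sq_le_sq' ?_ (by positivity) |>.2
      rw [mul_pow, PiLp.sq_dist_eq_sum, hS,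
        Real.sq_sqrt (Finset.sum_nonneg fun i _ => sq_nonneg _)]
      exact Finset.sum_mul_sq_le_sq_mul_sq _ _ _
    have hsum : ∑ i, f (x i) - ∑ i, f (y i) ≤ ∑ i, h (x i) * dist (x i) (y i) := by
      rw [← Finset.sum_sub_distrib]
      exact Finset.sum_le_sum fun i _ => hfh _ _
    have hy' : ∑ i, f (y i) ≤ m := hy
    have : S * dist x y ≤ S * r' := by gcongr
    linarith
  have ht : Tendsto (fun r' : ℝ => m + r' * S) (𝓝[>] r) (𝓝 (m + r * S)) :=
    tendsto_nhdsWithin_of_tendsto_nhds (Continuous.tendsto (by fun_prop) r)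
  refine ge_of_tendsto ht ?_
  filter_upwards [self_mem_nhdsWithin] with r' hr' using key r' hr'

/-- Concentration, applied to a sublevel set of `x ↦ ∑ i, f (x i)`, as a deviation inequality with
the random amplitude `√(∑ i, h (x i) ^ 2)`. -/
lemma DimFreeConvexConcentration.measureReal_sum_gt_le {X : Type*} [MetricSpace X]
    [SecondCountableTopology X] [MeasurableSpace X] [BorelSpace X] {μ : Measure X}
    [IsProbabilityMeasure μ] {α : ℝ → ℝ} (hμ : DimFreeConvexConcentration μ α) {f h : X → ℝ}
    (hf : IsGeodesicallyConvexFun f) (hfm : Measurable f)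
    (hfh : ∀ x y, f x - f y ≤ h x * dist x y) {n : ℕ} (hn : 1 ≤ n) {m r : ℝ} (hr : 0 ≤ r)
    (hm : 1 / 2 ≤ (Measure.pi (fun _ : Fin n => μ)).real {x | ∑ i, f (x i) ≤ m}) :
    (Measure.pi (fun _ : Fin n => μ)).real
      {x | m + r * √(∑ i, h (x i) ^ 2) < ∑ i, f (x i)} ≤ α r := by
  set A : Set (PiLp 2 (fun _ : Fin n => X)) := {x | ∑ i, f (x i) ≤ m}
  have hA : MeasurableSet (WithLp.toLp 2 ⁻¹' A : Set (Fin n → X)) :=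
    measurableSet_le (f := fun x : Fin n → X => ∑ i, f (x i)) (by fun_prop) measurable_const
  have hcon := hμ n hn A hA (hf.isGeodesicallyConvexSet_sum_le m) hm r hr
  have hTm : MeasurableSet (WithLp.toLp 2 ⁻¹' Metric.cthickening r A : Set (Fin n → X)) :=
    (Metric.isClosed_cthickening.preimage (PiLp.continuous_toLp 2 _)).measurableSet
  have hsub : {x : Fin n → X | m + r * √(∑ i, h (x i) ^ 2) < ∑ i, f (x i)} ⊆
      (WithLp.toLp 2 ⁻¹' Metric.cthickening r A)ᶜ := by
    intro x hx hx'
    exact absurd (sum_le_of_mem_cthickening hfh hr hx') (not_le.2 hx)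
  calc _ ≤ _ := measureReal_mono hsub
    _ ≤ α r := by rw [measureReal_compl hTm, probReal_univ]; linarith

/-! ### Gaussian tails -/

lemma gaussianReal_real_Iic_neg (a : ℝ) :
    (gaussianReal 0 1).real (Iic (-a)) = (gaussianReal 0 1).real (Ici a) := by
  have h : (gaussianReal 0 1).map (fun x => -x) = gaussianReal 0 1 := by
    rw [gaussianReal_map_neg, neg_zero]
  conv_lhs => rw [← h]
  rw [map_measureReal_apply measurable_neg measurableSet_Iic]
  congr 1
  ext x
  simp

lemma half_le_gaussianTail_zero : 1 / 2 ≤ gaussianTail 0 := by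
  have h1 := gaussianReal_real_Iic_neg 0
  rw [neg_zero] at h1
  have h2 : (gaussianReal 0 1).real univ ≤
      (gaussianReal 0 1).real (Iic 0) + (gaussianReal 0 1).real (Ici 0) := by
    rw [← Iic_union_Ici (a := (0 : ℝ))]
    exact measureReal_union_le _ _
  rw [probReal_univ, h1] at h2
  unfold gaussianTail
  linarith

lemma gaussianTail_lt_half {a : ℝ} (ha : 0 < a) : gaussianTail a < 1 / 2 := by
  have hpos : 0 < (gaussianReal 0 1).real (Ioo (-a) a) := by
    refine ENNReal.toReal_pos (fun h => ?_) (measure_ne_top _ _)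
    have := gaussianReal_absolutelyContinuous' 0 one_ne_zero h
    rw [Real.volume_Ioo, ENNReal.ofReal_eq_zero] at this
    linarith
  have hd1 : Disjoint (Iic (-a)) (Ioo (-a) a) :=
    Set.disjoint_left.2 fun x hx hx' => absurd hx'.1 (not_lt.2 hx)
  have hd2 : Disjoint (Iic (-a) ∪ Ioo (-a) a) (Ici a) := by
    refine Set.disjoint_left.2 fun x hx hx' => ?_
    have hx'' : a ≤ x := hx'
    rcases hx with hx | hx
    · have : x ≤ -a := hx
      linarith
    · linarith [hx.2]
  have h := measureReal_le_one (μ := gaussianReal 0 1)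
    (s := (Iic (-a) ∪ Ioo (-a) a) ∪ Ici a)
  rw [measureReal_union hd2 measurableSet_Ici, measureReal_union hd1 measurableSet_Ioo,
    gaussianReal_real_Iic_neg] at h
  unfold gaussianTail
  linarith

lemma gaussianTail_eq_Ioi (a : ℝ) : gaussianTail a = (gaussianReal 0 1).real (Ioi a) := by
  have := nullSingletonClass_gaussianReal (μ := 0) (v := 1) one_ne_zero
  exact (measureReal_congr Ioi_ae_eq_Ici).symm

lemma gaussianTail_antitone : Antitone gaussianTail := fun _ _ h =>
  measureReal_mono (Ici_subset_Ici.2 h)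

lemma gaussianTailInv_le {a x : ℝ} (h : gaussianTail x ≤ a) :
    gaussianTailInv a ≤ (x : EReal) :=
  sInf_le ⟨x, h, rfl⟩

lemma gaussianTailInv_pos {a : ℝ} (ha : a < 1 / 2) : 0 < gaussianTailInv a := by
  -- Right continuity at `0`: the half-lines `[1 / (n + 1), ∞)` exhaust `(0, ∞)`.
  have hU : (⋃ n : ℕ, Ici (1 / ((n : ℝ) + 1))) = Ioi (0 : ℝ) := by
    ext x
    simp only [mem_iUnion, mem_Ici, mem_Ioi]
    exact ⟨fun ⟨n, hn⟩ => lt_of_lt_of_le (by positivity) hn,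
      fun hx => (exists_nat_one_div_lt hx).imp fun n hn => hn.le⟩
  have hmono : Monotone fun n : ℕ => Ici (1 / ((n : ℝ) + 1)) := fun n m hnm =>
    Ici_subset_Ici.2 (one_div_le_one_div_of_le (by positivity) (by gcongr))
  have ht := tendsto_measure_iUnion_atTop (μ := gaussianReal 0 1) hmono
  rw [hU] at ht
  have ht' := (ENNReal.tendsto_toReal (measure_ne_top _ _)).comp ht
  have hlim : a < (gaussianReal 0 1 (Ioi 0)).toReal := by
    have := half_le_gaussianTail_zero
    rw [gaussianTail_eq_Ioi] at this
    exact ha.trans_le this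
  obtain ⟨n, hn⟩ := (ht'.eventually_const_lt hlim).exists
  have hx : (0 : ℝ) < 1 / ((n : ℝ) + 1) := by positivity
  refine lt_of_lt_of_le (EReal.coe_pos.2 hx) (le_sInf ?_)
  rintro _ ⟨y, hy, rfl⟩
  refine EReal.coe_le_coe_iff.2 (le_of_not_gt fun hlt => ?_)
  exact absurd (hn.trans_le (gaussianTail_antitone hlt.le)) (not_lt.2 hy)

/-! ### The Gaussian limit -/

lemma MeasureTheory.TendstoInDistribution.le_liminf_of_isOpen {Ω Ω' : Type*} {mΩ : MeasurableSpace Ω}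
    {mΩ' : MeasurableSpace Ω'} {P : Measure Ω} {P' : Measure Ω'} [IsProbabilityMeasure P]
    [IsProbabilityMeasure P'] {X : ℕ → Ω → ℝ} {Z : Ω' → ℝ}
    (h : TendstoInDistribution X atTop Z (fun _ => P) P') {G : Set ℝ} (hG : IsOpen G) :
    P' (Z ⁻¹' G) ≤ liminf (fun n => P (X n ⁻¹' G)) atTop := by
  have := ProbabilityMeasure.le_liminf_measure_open_of_tendsto h.tendsto hG
  simp only [ProbabilityMeasure.coe_mk] at this
  rw [Measure.map_apply_of_aemeasurable h.aemeasurable_limit hG.measurableSet] at this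
  refine this.trans_eq ?_
  congr 1
  ext n
  exact Measure.map_apply_of_aemeasurable (h.forall_aemeasurable n) hG.measurableSet

/-- If, for all `n`, moving up from a median-type level `m` of `∑ i, f (x i)` by
`r * √(∑ i, h (x i) ^ 2)` leaves probability at most `a`, then the same holds in the Gaussian
limit. The level is taken to be `n * 𝔼 f + δ * √n`; the central limit theorem handles the sum of
the `f (x i)` and the law of large numbers the amplitude. -/
lemma gaussianTail_le_of_forall_pi {X : Type*} [MeasurableSpace X] {μ : Measure X}
    [IsProbabilityMeasure μ] {f h : X → ℝ} (hfm : Measurable f) (hf : MemLp f 2 μ)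
    (hvar : 0 < Var[f; μ]) (hhm : Measurable h) (hh : Integrable (fun x => h x ^ 2) μ) {r a : ℝ}
    (hdev : ∀ n : ℕ, 1 ≤ n → ∀ m : ℝ,
      1 / 2 ≤ (Measure.pi (fun _ : Fin n => μ)).real {x | ∑ i, f (x i) ≤ m} →
      (Measure.pi (fun _ : Fin n => μ)).real
        {x | m + r * √(∑ i, h (x i) ^ 2) < ∑ i, f (x i)} ≤ a) {δ : ℝ} (hδ : 0 < δ) :
    gaussianTail ((δ + r * √(∫ x, h x ^ 2 ∂μ)) / √Var[f; μ]) ≤ a := by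
  obtain ⟨Ω, mΩ, P, Y, hYm, hYlaw, hYind, hP⟩ := exists_iid ℕ μ
  set σ := √Var[f; μ] with hσ
  have hσ0 : 0 < σ := Real.sqrt_pos.2 hvar
  set c := P[fun ω => f (Y 0 ω)] with hc
  set H := ∫ x, h x ^ 2 ∂μ with hH
  have hpi : ∀ n : ℕ, ∀ S : Set (Fin n → X), MeasurableSet S →
      (Measure.pi (fun _ : Fin n => μ)).real S = P.real {ω | (fun i : Fin n => Y i ω) ∈ S} := by
    intro n S hS
    have hind : iIndepFun (fun (i : Fin n) => Y i) P :=
      hYind.precomp (g := fun i : Fin n => (i : ℕ)) Fin.val_injective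
    have := (iIndepFun_iff_map_fun_eq_pi_map fun i => (hYm _).aemeasurable).1 hind
    simp only [(hYlaw _).map_eq] at this
    rw [← this, map_measureReal_apply (by fun_prop) hS]
    rfl
  have hident : ∀ i, IdentDistrib (Y i) (Y 0) P P := fun i =>
    ⟨(hYm i).aemeasurable, (hYm 0).aemeasurable, by rw [(hYlaw i).map_eq, (hYlaw 0).map_eq]⟩
  have hY0 : MeasurePreserving (Y 0) P μ := ⟨hYm 0, (hYlaw 0).map_eq⟩
  set W : ℕ → Ω → ℝ := fun n ω => (√n)⁻¹ * (∑ k ∈ Finset.range n, f (Y k ω) - n * c) with hW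
  set V : ℕ → Ω → ℝ := fun n ω => (∑ k ∈ Finset.range n, h (Y k ω) ^ 2) / n with hV
  have hVarY : Var[fun ω => f (Y 0 ω); P] = Var[f; μ] := by
    have := variance_map (μ := P) (X := f) (Y := Y 0)
      (by rw [hY0.map_eq]; exact hfm.aemeasurable) (hYm 0).aemeasurable
    rw [hY0.map_eq] at this
    exact this.symm
  have hWlim : TendstoInDistribution W atTop (fun x : ℝ => σ * x) (fun _ => P)
      (gaussianReal 0 1) := by
    refine tendstoInDistribution_inv_sqrt_mul_sum_sub (X := fun k ω => f (Y k ω)) ?_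
      (hf.comp_measurePreserving hY0) (hYind.comp (fun _ => f) fun _ => hfm)
      (fun i => (hident i).comp hfm)
    have := gaussianReal_const_mul (P := gaussianReal 0 1) (μ := 0) (v := 1)
      (X := fun x : ℝ => x) ⟨aemeasurable_id, Measure.map_id⟩ σ
    convert this using 2
    · simp
    · ext
      rw [hVarY]
      simp [hσ, Real.sq_sqrt, hvar.le]
  have hVlim : TendstoInMeasure P V atTop (fun _ => H) := by
    refine tendstoInMeasure_of_tendsto_ae
      (fun n => (by fun_prop : Measurable (V n)).aestronglyMeasurable) ?_
    have hmH : Measurable fun x => h x ^ 2 := hhm.pow_const 2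
    have := strong_law_ae_real (μ := P) (fun k ω => h (Y k ω) ^ 2)
      (hY0.integrable_comp_of_integrable hh)
      (fun i j hij => (hYind.indepFun hij).comp hmH hmH)
      (fun i => (hident i).comp hmH)
    have hint : ∫ ω, h (Y 0 ω) ^ 2 ∂P = H := by
      rw [hH, ← hY0.map_eq, integral_map (hYm 0).aemeasurable hmH.aestronglyMeasurable]
    simpa only [hint] using this
  have hTlim := hWlim.continuous_comp_prodMk_of_tendstoInMeasure_const
    (g := fun p : ℝ × ℝ => p.1 - r * √p.2) (by fun_prop) hVlim
    (fun n => (by fun_prop : Measurable (V n)).aemeasurable)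
  have hhalf : ∀ᶠ n in atTop, (1 / 2 : ℝ) < P.real (W n ⁻¹' Iio δ) := by
    have h1 := hWlim.le_liminf_of_isOpen (isOpen_Iio (a := δ))
    have h2 : ENNReal.ofReal (1 / 2) < gaussianReal 0 1 ((fun x : ℝ => σ * x) ⁻¹' Iio δ) := by
      have hset : (fun x : ℝ => σ * x) ⁻¹' Iio δ = (Ici (δ / σ))ᶜ := by
        ext x
        simp [lt_div_iff₀ hσ0, mul_comm]
      rw [hset, ENNReal.ofReal_lt_iff_lt_toReal (by norm_num) (measure_ne_top _ _)]
      change _ < (gaussianReal 0 1).real _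
      rw [measureReal_compl measurableSet_Ici, probReal_univ]
      have := gaussianTail_lt_half (div_pos hδ hσ0)
      unfold gaussianTail at this
      linarith
    filter_upwards [eventually_lt_of_lt_liminf (h2.trans_le h1)] with n hn
    exact (ENNReal.ofReal_lt_iff_lt_toReal (by norm_num) (measure_ne_top _ _)).1 hn
  have hev : ∀ᶠ n in atTop,
      P ((fun ω => W n ω - r * √(V n ω)) ⁻¹' Ioi δ) ≤ ENNReal.ofReal a := by
    filter_upwards [hhalf, eventually_ge_atTop 1] with n hn hn1
    have hn0 : (0 : ℝ) < n := by exact_mod_cast hn1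
    have hs0 : 0 < √(n : ℝ) := Real.sqrt_pos.2 hn0
    have hd := hdev n hn1 (n * c + δ * √n) ?_
    · rw [hpi n _ (measurableSet_lt (by fun_prop) (by fun_prop))] at hd
      refine (ENNReal.le_ofReal_iff_toReal_le (measure_ne_top _ _)
        (measureReal_nonneg.trans hd)).2 ((measureReal_mono fun ω hω => ?_).trans hd)
      simp only [mem_preimage, mem_Ioi, mem_ofPred_eq] at hω ⊢
      rw [← Finset.sum_range (fun k => h (Y k ω) ^ 2), ← Finset.sum_range (fun k => f (Y k ω))]
      have hω' : δ + r * √(V n ω) < W n ω := by linarith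
      have hVs : √(∑ k ∈ Finset.range n, h (Y k ω) ^ 2) = √n * √(V n ω) := by
        rw [← Real.sqrt_mul hn0.le, hV, mul_div_cancel₀ _ hn0.ne']
      have hWs : √n * W n ω = ∑ k ∈ Finset.range n, f (Y k ω) - n * c := by
        rw [hW, mul_inv_cancel_left₀ hs0.ne']
      rw [hVs]
      nlinarith [mul_lt_mul_of_pos_left hω' hs0]
    · rw [hpi n _ (measurableSet_le (by fun_prop) (by fun_prop))]
      refine hn.le.trans (measureReal_mono fun ω hω => ?_)
      simp only [mem_preimage, mem_Iio, mem_ofPred_eq] at hω ⊢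
      rw [← Finset.sum_range (fun k => f (Y k ω))]
      have hWs : √n * W n ω = ∑ k ∈ Finset.range n, f (Y k ω) - n * c := by
        rw [hW, mul_inv_cancel_left₀ hs0.ne']
      nlinarith [mul_lt_mul_of_pos_left hω hs0]
  have hlim := hTlim.le_liminf_of_isOpen (isOpen_Ioi (a := δ))
  have hlim' : gaussianReal 0 1 ((fun x : ℝ => σ * x - r * √H) ⁻¹' Ioi δ) ≤ ENNReal.ofReal a :=
    hlim.trans (liminf_le_of_frequently_le' hev.frequently)
  have hset : (fun x : ℝ => σ * x - r * √H) ⁻¹' Ioi δ = Ioi ((δ + r * √H) / σ) := by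
    ext x
    simp [div_lt_iff₀ hσ0, lt_sub_iff_add_lt, mul_comm]
  rw [hset] at hlim'
  have ha : 0 ≤ a := by
    obtain ⟨n, hn, hn1⟩ := (hhalf.and (eventually_ge_atTop 1)).exists
    by_contra ha
    rw [ENNReal.ofReal_eq_zero.2 (not_le.1 ha).le, nonpos_iff_eq_zero] at hlim'
    have := gaussianReal_absolutelyContinuous' 0 one_ne_zero hlim'
    simp at this
  rw [gaussianTail_eq_Ioi]
  exact (ENNReal.le_ofReal_iff_toReal_le (measure_ne_top _ _) ha).1 hlim'

/-! ### The Poincaré inequality -/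

section poincare
variable {X : Type*} [MetricSpace X] [SecondCountableTopology X] [MeasurableSpace X] [BorelSpace X]
  {μ : Measure X} [IsProbabilityMeasure μ] {α : ℝ → ℝ} {f : X → ℝ}

theorem DimFreeConvexConcentration.mul_evariance_le (hX : IsGeodesicMetricSpace X)
    (hμ : DimFreeConvexConcentration μ α) (hL : LipschitzOnBalls f)
    (hf : IsGeodesicallyConvexFun f) (hf2 : MemLp f 2 μ) :
    concentrationConst α * evariance f μ ≤ ∫⁻ x, gradMinus f x ^ 2 ∂μ := by
  obtain ⟨h, hhm, hh0, hfh, hhle⟩ := hf.exists_measurable_slope hX hL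
  have hfm := hL.continuous.measurable
  rw [← hf2.ofReal_variance_eq]
  rcases (variance_nonneg f μ).eq_or_lt with hv | hv
  · simp [← hv]
  rcases eq_or_ne (∫⁻ x, gradMinus f x ^ 2 ∂μ) ∞ with htop | htop
  · simp [htop]
  have hle : ∫⁻ x, ENNReal.ofReal (h x ^ 2) ∂μ ≤ ∫⁻ x, gradMinus f x ^ 2 ∂μ := by
    refine lintegral_mono fun x => ?_
    rw [ENNReal.ofReal_pow (hh0 x)]
    gcongr
    exact hhle x
  have hint : Integrable (fun x => h x ^ 2) μ := by
    refine ⟨(hhm.pow_const 2).aestronglyMeasurable, ?_⟩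
    rw [hasFiniteIntegral_iff_ofReal (ae_of_all _ fun x => sq_nonneg _)]
    exact hle.trans_lt htop.lt_top
  set σ := √Var[f; μ] with hσ
  have hσ0 : 0 < σ := Real.sqrt_pos.2 hv
  set H := ∫ x, h x ^ 2 ∂μ with hH
  have hH0 : 0 ≤ H := integral_nonneg fun x => sq_nonneg _
  have hquot : ∀ r : ℝ, 0 < r →
      (gaussianTailInv (α r) / (r : EReal)).toENNReal ≤ ENNReal.ofReal (√H / σ) := by
    intro r hr
    have hinv : gaussianTailInv (α r) ≤ ((r * √H / σ : ℝ) : EReal) := by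
      have ht : Tendsto (fun δ : ℝ => (((δ + r * √H) / σ : ℝ) : EReal)) (𝓝[>] 0)
          (𝓝 (((0 + r * √H) / σ : ℝ) : EReal)) :=
        (continuous_coe_real_ereal.tendsto _).comp
          (tendsto_nhdsWithin_of_tendsto_nhds (Continuous.tendsto (by fun_prop) 0))
      rw [zero_add] at ht
      refine ge_of_tendsto ht ?_
      filter_upwards [self_mem_nhdsWithin] with δ hδ
      exact gaussianTailInv_le (gaussianTail_le_of_forall_pi hfm hf2 hv hhm hint
        (fun n hn m hm => hμ.measureReal_sum_gt_le hf hfm hfh hn hr.le hm) hδ)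
    have hdiv : gaussianTailInv (α r) / (r : EReal) ≤ ((√H / σ : ℝ) : EReal) := by
      refine (EReal.div_le_div_right_of_nonneg (EReal.coe_nonneg.2 hr.le) hinv).trans_eq ?_
      rw [← EReal.coe_div]
      congr 1
      field_simp
    exact (EReal.toENNReal_le_toENNReal hdiv).trans_eq (EReal.toENNReal_of_ne_top (by simp))
  have hconst : concentrationConst α ≤ ENNReal.ofReal (√H / σ) ^ 2 := by
    unfold concentrationConst
    gcongr
    exact iSup₂_le fun r hr => hquot r hr.1
  calc concentrationConst α * ENNReal.ofReal Var[f; μ]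
      ≤ ENNReal.ofReal (√H / σ) ^ 2 * ENNReal.ofReal Var[f; μ] := by gcongr
    _ = ENNReal.ofReal H := by
        rw [← ENNReal.ofReal_pow (by positivity), ← ENNReal.ofReal_mul (by positivity), div_pow,
          Real.sq_sqrt hH0, hσ, Real.sq_sqrt hv.le, div_mul_cancel₀ _ hv.ne']
    _ = ∫⁻ x, ENNReal.ofReal (h x ^ 2) ∂μ :=
        ofReal_integral_eq_lintegral_ofReal hint (ae_of_all _ fun x => sq_nonneg _)
    _ ≤ _ := hle

end poincare

/-! ### Square integrability of convex Lipschitz functions -/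

lemma concentrationConst_pos {α : ℝ → ℝ}
    (hα : IntegrableOn (fun r : ℝ => r * α r) (Ioi 0)) : 0 < concentrationConst α := by
  have hex : ∃ r : ℝ, 0 < r ∧ α r < 1 / 2 := by
    by_contra! hcon
    have hint : IntegrableOn (fun _ : ℝ => (1 / 2 : ℝ)) (Ioi 1) := by
      refine (hα.mono_set (Ioi_subset_Ioi zero_le_one)).mono' (by fun_prop) ?_
      filter_upwards [ae_restrict_mem measurableSet_Ioi] with r hr
      have hr1 : (1 : ℝ) < r := hr
      rw [Real.norm_of_nonneg (by norm_num)]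
      nlinarith [hcon r (by linarith)]
    simp [integrableOn_const_iff] at hint
  obtain ⟨r, hr, hαr⟩ := hex
  refine ENNReal.pow_pos (lt_of_lt_of_le ?_ (le_iSup₂_of_le r ⟨hr, hαr.le⟩ le_rfl)) 2
  rw [EReal.toENNReal_pos_iff]
  exact EReal.div_pos (gaussianTailInv_pos hαr) (EReal.coe_pos.2 hr) (EReal.coe_ne_top r)

lemma exists_half_le_measureReal_le {X : Type*} [MeasurableSpace X] (μ : Measure X)
    [IsProbabilityMeasure μ] (g : X → ℝ) : ∃ M : ℝ, 0 ≤ M ∧ 1 / 2 ≤ μ.real {x | g x ≤ M} := by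
  have hU : (⋃ n : ℕ, {x | g x ≤ n}) = univ :=
    eq_univ_of_forall fun x => mem_iUnion.2 (exists_nat_ge (g x))
  have hmono : Monotone fun n : ℕ => {x | g x ≤ n} := fun n m hnm x (hx : g x ≤ n) =>
    hx.trans (by exact_mod_cast hnm)
  have ht := (ENNReal.tendsto_toReal (measure_ne_top _ _)).comp
    (tendsto_measure_iUnion_atTop (μ := μ) hmono)
  rw [hU, measure_univ, ENNReal.toReal_one] at ht
  obtain ⟨n, hn⟩ := (ht.eventually_const_lt (by norm_num : (1 / 2 : ℝ) < 1)).exists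
  exact ⟨n, n.cast_nonneg, hn.le⟩

section lipschitz
variable {X : Type*} [MetricSpace X] {f : X → ℝ}

lemma LipschitzWith.sub_le_mul_dist {K : NNReal} (hL : LipschitzWith K f) (x y : X) :
    f x - f y ≤ K * dist x y := by
  have := hL.dist_le_mul x y
  rw [Real.dist_eq] at this
  exact (le_abs_self _).trans this

lemma LipschitzWith.lipschitzOnBalls {K : NNReal} (hL : LipschitzWith K f) :
    LipschitzOnBalls f := fun _ _ => ⟨K, hL.lipschitzOnWith⟩

lemma LipschitzWith.gradMinus_le {K : NNReal} (hL : LipschitzWith K f) (x : X) :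
    gradMinus f x ≤ K :=
  gradMinus_le_of_eventually (Eventually.of_forall fun y => by
    rw [dist_comm]; exact hL.sub_le_mul_dist x y)

lemma IsGeodesicallyConvexFun.max_const (hf : IsGeodesicallyConvexFun f) (c : ℝ) :
    IsGeodesicallyConvexFun fun x => max (f x) c := by
  intro γ hγ t ht
  have h := hf γ hγ t ht
  have h0 : 0 ≤ 1 - t := sub_nonneg.2 ht.2
  refine max_le (h.trans ?_) ?_
  · have := mul_le_mul_of_nonneg_left (le_max_left (f (γ 0)) c) h0
    have := mul_le_mul_of_nonneg_left (le_max_left (f (γ 1)) c) ht.1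
    linarith
  · have := mul_le_mul_of_nonneg_left (le_max_right (f (γ 0)) c) h0
    have := mul_le_mul_of_nonneg_left (le_max_right (f (γ 1)) c) ht.1
    linarith

variable [SecondCountableTopology X] [MeasurableSpace X] [BorelSpace X]
  {μ : Measure X} [IsProbabilityMeasure μ] {α : ℝ → ℝ}

/-- One-dimensional concentration bounds the upper tail of a convex Lipschitz function by `α`, and
`∫ r * α r` is, up to constants, the second moment of the positive part of `f - M`. Lower tails are
not accessible in this way, because superlevel sets of `f` need not be convex; they are truncated
here. -/
lemma DimFreeConvexConcentration.memLp_max_const (hμ : DimFreeConvexConcentration μ α)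
    (hα : IntegrableOn (fun r : ℝ => r * α r) (Ioi 0)) {K : NNReal} (hL : LipschitzWith K f)
    (hf : IsGeodesicallyConvexFun f) (c : ℝ) : MemLp (fun x => max (f x) c) 2 μ := by
  have hfm : Measurable f := hL.continuous.measurable
  obtain ⟨M, -, hM⟩ := exists_half_le_measureReal_le μ f
  set L : ℝ := K + 1 with hLdef
  have hL0 : 0 < L := by positivity
  have hfh : ∀ x y, f x - f y ≤ (fun _ => L) x * dist x y := fun x y =>
    (hL.sub_le_mul_dist x y).trans (by gcongr; linarith)
  have heval : MeasurePreserving (Function.eval 0) (Measure.pi (fun _ : Fin 1 => μ)) μ :=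
    measurePreserving_eval _ 0
  have htail : ∀ r : ℝ, 0 ≤ r → μ.real {x | M + r * L < f x} ≤ α r := by
    intro r hr
    have h1 := hμ.measureReal_sum_gt_le hf hfm hfh le_rfl (m := M) hr ?_
    · simp only [Finset.univ_unique, Fin.default_eq_zero, Finset.sum_singleton,
        Real.sqrt_sq hL0.le] at h1
      rw [← heval.measureReal_preimage
        (measurableSet_lt measurable_const hfm).nullMeasurableSet]
      exact h1
    · simp only [Finset.univ_unique, Fin.default_eq_zero, Finset.sum_singleton]
      rw [← heval.measureReal_preimage
        (measurableSet_le hfm measurable_const).nullMeasurableSet] at hM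
      exact hM
  set u : X → ℝ := fun x => max ((f x - M) / L) 0 with hu
  have hum : Measurable u := by fun_prop
  have hu0 : ∀ x, 0 ≤ u x := fun x => le_max_right _ _
  have hu2 : MemLp u 2 μ := by
    rw [memLp_two_iff_integrable_sq hum.aestronglyMeasurable]
    refine ⟨(hum.pow_const 2).aestronglyMeasurable, ?_⟩
    rw [hasFiniteIntegral_iff_ofReal (ae_of_all _ fun x => sq_nonneg _)]
    have hlc := lintegral_rpow_eq_lintegral_meas_lt_mul μ (ae_of_all _ hu0) hum.aemeasurable
      (zero_lt_two (α := ℝ))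
    simp only [Real.rpow_ofNat] at hlc
    rw [hlc]
    refine ENNReal.mul_lt_top ENNReal.ofReal_lt_top ?_
    refine lt_of_le_of_lt (setLIntegral_mono' measurableSet_Ioi fun t ht => ?_)
      hα.lintegral_lt_top
    have ht0 : (0 : ℝ) < t := ht
    have hsub : {x | t < u x} ⊆ {x | M + t * L < f x} := by
      intro x hx
      have hx' : t < max ((f x - M) / L) 0 := hx
      rcases lt_max_iff.1 hx' with h | h
      · rw [lt_div_iff₀ hL0] at h
        simp only [mem_ofPred_eq]
        linarith
      · exact absurd h (not_lt.2 ht0.le)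
    have hmeas : μ {x | t < u x} ≤ ENNReal.ofReal (α t) := by
      rw [ENNReal.le_ofReal_iff_toReal_le (measure_ne_top _ _)
        (measureReal_nonneg.trans (htail t ht0.le))]
      exact (measureReal_mono hsub).trans (htail t ht0.le)
    rw [mul_comm t, ENNReal.ofReal_mul' ht0.le]
    gcongr
    norm_num
  have hb : MemLp (fun x => L * u x + (|M| + |c|)) 2 μ :=
    (hu2.const_mul L).add (memLp_const _)
  refine hb.mono (by fun_prop : Measurable _).aestronglyMeasurable (ae_of_all _ fun x => ?_)
  have h1 : f x - M ≤ L * u x := by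
    have := le_max_left ((f x - M) / L) 0
    rw [div_le_iff₀ hL0] at this
    linarith
  have h2 : 0 ≤ L * u x := mul_nonneg hL0.le (hu0 x)
  rw [Real.norm_eq_abs, Real.norm_of_nonneg (by positivity)]
  refine abs_le.2 ⟨?_, max_le ?_ ?_⟩
  · linarith [le_max_right (f x) c, neg_abs_le c, abs_nonneg M]
  · linarith [le_abs_self M, abs_nonneg c]
  · linarith [le_abs_self c, abs_nonneg M]

/-- The truncations `max f (-k)` have variance bounded by `K ^ 2` over the (positive) Poincaré
constant, and by Chebyshev's inequality their means are bounded as well, since `|f| ≤ M` on a set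
of measure at least `1 / 2`. Fatou's lemma gives the second moment of `f`. -/
lemma DimFreeConvexConcentration.memLp_two (hX : IsGeodesicMetricSpace X)
    (hμ : DimFreeConvexConcentration μ α)
    (hα : IntegrableOn (fun r : ℝ => r * α r) (Ioi 0)) {K : NNReal} (hL : LipschitzWith K f)
    (hf : IsGeodesicallyConvexFun f) : MemLp f 2 μ := by
  have hfm : Measurable f := hL.continuous.measurable
  set F : ℕ → X → ℝ := fun k x => max (f x) (-(k : ℝ)) with hF
  have hFm : ∀ k, Measurable (F k) := fun k => hfm.max measurable_const
  have hF2 : ∀ k, MemLp (F k) 2 μ := fun k => hμ.memLp_max_const hα hL hf _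
  have hlam := concentrationConst_pos hα
  set C := (K : ℝ≥0∞) ^ 2 / concentrationConst α with hC
  have hCtop : C ≠ ∞ := ENNReal.div_ne_top (by simp) hlam.ne'
  set v := C.toReal with hv
  have hv0 : 0 ≤ v := ENNReal.toReal_nonneg
  have hvar : ∀ k, Var[F k; μ] ≤ v := by
    intro k
    have hLk : LipschitzWith K (F k) := hL.max_const _
    have h1 := hμ.mul_evariance_le hX hLk.lipschitzOnBalls (hf.max_const _) (hF2 k)
    have h2 : ∫⁻ x, gradMinus (F k) x ^ 2 ∂μ ≤ (K : ℝ≥0∞) ^ 2 := by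
      calc _ ≤ ∫⁻ _, (K : ℝ≥0∞) ^ 2 ∂μ :=
            lintegral_mono fun x => by gcongr; exact hLk.gradMinus_le x
        _ = _ := by simp
    rw [← (hF2 k).ofReal_variance_eq] at h1
    refine (ENNReal.ofReal_le_iff_le_toReal hCtop).1 ?_
    rw [hC, ENNReal.le_div_iff_mul_le (Or.inl hlam.ne') (Or.inr (by simp)), mul_comm]
    exact h1.trans h2
  obtain ⟨M, hM0, hM⟩ := exists_half_le_measureReal_le μ fun x => |f x|
  set c : ℝ := 2 * √v + 1 with hc
  have hc0 : 0 < c := by positivity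
  have hmean : ∀ k : ℕ, M ≤ k → |μ[F k]| ≤ M + c := by
    intro k hk
    have hcheb := meas_ge_le_variance_div_sq (hF2 k) hc0
    have hsmall : μ.real {x | c ≤ |F k x - μ[F k]|} ≤ 1 / 4 := by
      refine ENNReal.toReal_le_of_le_ofReal (by norm_num)
        (hcheb.trans (ENNReal.ofReal_le_ofReal ?_))
      rw [div_le_iff₀ (by positivity)]
      nlinarith [hvar k, Real.sq_sqrt hv0, Real.sqrt_nonneg v]
    obtain ⟨x, hx1, hx2⟩ : ∃ x, |f x| ≤ M ∧ |F k x - μ[F k]| < c := by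
      by_contra! hcon
      have : μ.real {x | |f x| ≤ M} ≤ μ.real {x | c ≤ |F k x - μ[F k]|} :=
        measureReal_mono fun x hx => hcon x hx
      linarith
    have hFx : F k x = f x := max_eq_left (by linarith [(abs_le.1 hx1).1])
    rw [hFx] at hx2
    rw [abs_le] at hx1 ⊢
    rw [abs_lt] at hx2
    constructor <;> linarith
  have hbound : ∀ k : ℕ, M ≤ k →
      ∫⁻ x, ENNReal.ofReal (F k x ^ 2) ∂μ ≤ ENNReal.ofReal (v + (M + c) ^ 2) := by
    intro k hk
    have hi := (memLp_two_iff_integrable_sq (hFm k).aestronglyMeasurable).1 (hF2 k)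
    rw [← ofReal_integral_eq_lintegral_ofReal hi (ae_of_all _ fun x => sq_nonneg _)]
    refine ENNReal.ofReal_le_ofReal ?_
    have h1 := variance_eq_sub (hF2 k)
    have h2 : μ[F k] ^ 2 ≤ (M + c) ^ 2 := sq_le_sq' (abs_le.1 (hmean k hk)).1
      (abs_le.1 (hmean k hk)).2
    have h3 : μ[F k ^ 2] = ∫ x, F k x ^ 2 ∂μ := rfl
    linarith [hvar k]
  rw [memLp_two_iff_integrable_sq hfm.aestronglyMeasurable]
  refine ⟨(hfm.pow_const 2).aestronglyMeasurable, ?_⟩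
  rw [hasFiniteIntegral_iff_ofReal (ae_of_all _ fun x => sq_nonneg _)]
  have hlim : ∀ x, liminf (fun k => ENNReal.ofReal (F k x ^ 2)) atTop
      = ENNReal.ofReal (f x ^ 2) := by
    intro x
    refine Tendsto.liminf_eq (tendsto_const_nhds.congr' ?_)
    obtain ⟨N, hN⟩ := exists_nat_ge (-f x)
    filter_upwards [eventually_ge_atTop N] with k hk
    have : (N : ℝ) ≤ k := by exact_mod_cast hk
    have hFx : F k x = f x := max_eq_left (by linarith)
    rw [hFx]
  calc ∫⁻ x, ENNReal.ofReal (f x ^ 2) ∂μ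
      = ∫⁻ x, liminf (fun k => ENNReal.ofReal (F k x ^ 2)) atTop ∂μ := by simp only [hlim]
    _ ≤ liminf (fun k => ∫⁻ x, ENNReal.ofReal (F k x ^ 2) ∂μ) atTop :=
        lintegral_liminf_le fun k => ((hFm k).pow_const 2).ennreal_ofReal
    _ ≤ ENNReal.ofReal (v + (M + c) ^ 2) := by
        refine liminf_le_of_frequently_le' (Eventually.frequently ?_)
        obtain ⟨N, hN⟩ := exists_nat_ge M
        filter_upwards [eventually_ge_atTop N] with k hk
        exact hbound k (hN.trans (by exact_mod_cast hk))
    _ < ∞ := ENNReal.ofReal_lt_top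

end lipschitz

theorem theorem6p3 {X : Type*} [MetricSpace X] [CompleteSpace X] [SecondCountableTopology X]
    [MeasurableSpace X] [BorelSpace X] (hX : IsGeodesicMetricSpace X)
    (μ : Measure X) [IsProbabilityMeasure μ]
    (α : ℝ → ℝ) (hα_nonneg : ∀ r : ℝ, 0 ≤ r → 0 ≤ α r) (hα_anti : AntitoneOn α (Ici 0))
    (hμ : DimFreeConvexConcentration μ α) :
    (∀ f : X → ℝ, LipschitzOnBalls f → IsGeodesicallyConvexFun f → MemLp f 2 μ →
      concentrationConst α * evariance f μ ≤ ∫⁻ x, gradMinus f x ^ 2 ∂μ) ∧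
    (IntegrableOn (fun r : ℝ => r * α r) (Ioi 0) →
      ∀ f : X → ℝ, (∃ K : NNReal, LipschitzWith K f) → IsGeodesicallyConvexFun f →
        MemLp f 2 μ ∧ concentrationConst α * evariance f μ ≤ ∫⁻ x, gradMinus f x ^ 2 ∂μ) := by
  refine ⟨fun f hL hf hf2 => hμ.mul_evariance_le hX hL hf hf2, fun hα f ⟨K, hL⟩ hf => ?_⟩
  have hf2 := hμ.memLp_two hX hα hL hf
  exact ⟨hf2, hμ.mul_evariance_le hX hL.lipschitzOnBalls hf hf2⟩
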